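/- Let $N>0$ and $a\ne 0$ be real, put $(a_1,a_2,a_3)=(a,0,-a)$ and $\omega_j(x)=e^{-N(x^2/2-a_jx)}$ for $j=1,2,3$, and let $n_1,n_2,n_3\ge 1$ be integers with $n=n_1+n_2+n_3$. For nonnegative integers $k_1,k_2,k_3$ let $P_{k_1,k_2,k_3}$ be the monic polynomial of degree $k_1+k_2+k_3$ with $\int_{\mathbb R}P_{k_1,k_2,k_3}(x)x^m\omega_j(x)\,dx=0$ for $0\le m<k_j$, $j=1,2,3$ (multiple Hermite polynomial), let $h^{(j)}_{k_1,k_2,k_3}=\int_{\mathbb R}P_{k_1,k_2,k_3}(x)x^{k_j}\omega_j(x)\,dx$, and set $$c_1=\frac{-2\pi i}{h^{(1)}_{n_1-1,n_2,n_3}},\qquad c_2=\frac{-2\pi i}{h^{(2)}_{n_1,n_2-1,n_3}},\qquad c_3=\frac{-2\pi i}{h^{(3)}_{n_1,n_2,n_3-1}}.$$ Consider the Riemann–Hilbert problem of finding $Y:\mathbb C\setminus\mathbb R\to\mathbb C^{4\times4}$ such that 1. $Y$ is analytic on $\mathbb C\setminus\mathbb R$; 2. for every $x\in\mathbb R$ the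 limits $Y_\pm(x)$ of $Y(z)$ as $z\to x$ from the upper ($+$) and lower ($-$) half-plane exist, and $$Y_+(x)=Y_-(x)\begin{pmatrix}1&\omega_1(x)&\omega_2(x)&\omega_3(x)\\0&1&0&0\\0&0&1&0\\0&0&0&1\end{pmatrix};$$ 3. $Y(z)=\left(I+O(1/z)\right)\operatorname{diag}(z^{n},z^{-n_1},z^{-n_2},z^{-n_3})$ as $z\to\infty$, $z\in\mathbb C\setminus\mathbb R$. This problem has a unique solution $Y$, and the normalized solution $$\Psi_{n_1,n_2,n_3}(z)=\operatorname{diag}\left(1,\tfrac1{c_1},\tfrac1{c_2},\tfrac1{c_3}\right)Y(z)\operatorname{diag}\left(e^{-Nz^2/2},e^{-Na_1z},e^{-Na_2z},e^{-Na_3z}\right)$$ satisfies, for all $z\in\mathbb C\setminus\mathbb R$, the differential equation $$\Psi_{n_1,n_2,n_3}'(z)=N\begin{pmatrix}-z&\frac{n_1}{N}&\frac{n_2}{N}&\frac{n_3}{N}\\-1&-a&0&0\\-1&0&0&0\\-1&0&0&a\end{pmatrix}\Psi_{n_1,n_2,n_3}(z).$$ -/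

import Mathlib

namespace MultipleHermite

noncomputable section

/-- The shifts `(a₁, a₂, a₃) = (a, 0, -a)`. -/
def shift (a : ℝ) : Fin 3 → ℝ := ![a, 0, -a]

/-- The Gaussian weights `ω_j(x) = exp (-N (x² / 2 - a_j x))`. -/
def weight (N a : ℝ) (j : Fin 3) (x : ℝ) : ℝ :=
  Real.exp (-N * (x ^ 2 / 2 - shift a j * x))

/-- `P` is a monic (type II) multiple orthogonal polynomial of multi-index `k`: it is monic of
degree `k₁ + k₂ + k₃`, and `∫ P(x) x^m ω_j(x) dx = 0` for `m < k_j`, `j = 1, 2, 3`. -/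
def IsMultipleOrthogonal (N a : ℝ) (k : Fin 3 → ℕ) (P : Polynomial ℝ) : Prop :=
  P.Monic ∧ P.natDegree = ∑ j, k j ∧
    ∀ j : Fin 3, ∀ m : ℕ, m < k j → ∫ x : ℝ, P.eval x * x ^ m * weight N a j x = 0

open Classical in
/-- The multiple Hermite polynomial `P_{k₁,k₂,k₃}`. -/
def hermitePoly (N a : ℝ) (k : Fin 3 → ℕ) : Polynomial ℝ :=
  if h : ∃ P, IsMultipleOrthogonal N a k P then h.choose else 0

/-- `h^{(j)}_k = ∫ P_k(x) x^{k_j} ω_j(x) dx`. -/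
def hNorm (N a : ℝ) (k : Fin 3 → ℕ) (j : Fin 3) : ℝ :=
  ∫ x : ℝ, (hermitePoly N a k).eval x * x ^ (k j) * weight N a j x

/-- The constants `c_j = -2πi / h^{(j)}_{n - e_j}` (used for `n_j ≥ 1`). -/
def cConst (N a : ℝ) (n : Fin 3 → ℕ) (j : Fin 3) : ℂ :=
  -2 * Real.pi * Complex.I * ((hNorm N a (Function.update n j (n j - 1)) j : ℝ) : ℂ)⁻¹

/-- The jump matrix on the real line. -/
def jumpMatrix (N a : ℝ) (x : ℝ) : Matrix (Fin 4) (Fin 4) ℂ :=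
  !![1, (weight N a 0 x : ℂ), (weight N a 1 x : ℂ), (weight N a 2 x : ℂ);
     0, 1, 0, 0;
     0, 0, 1, 0;
     0, 0, 0, 1]

/-- `Y` solves the `4 × 4` Riemann-Hilbert problem with multi-index `n`. The values of `Y` on the
real line play no role. In `asymptotics`, `E z = Y z * diag (z^n, z^{-n₁}, z^{-n₂}, z^{-n₃})⁻¹`
is compared with the identity, entry by entry, as `z → ∞` in `ℂ \ ℝ`. -/
structure IsRHSolution (N a : ℝ) (n : Fin 3 → ℕ) (Y : ℂ → Matrix (Fin 4) (Fin 4) ℂ) : Prop where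
  analytic : ∀ i j, DifferentiableOn ℂ (fun z => Y z i j) {z : ℂ | z.im ≠ 0}
  jump : ∀ x : ℝ, ∃ Yplus Yminus : Matrix (Fin 4) (Fin 4) ℂ,
    Filter.Tendsto Y (nhdsWithin (x : ℂ) {z : ℂ | 0 < z.im}) (nhds Yplus) ∧
    Filter.Tendsto Y (nhdsWithin (x : ℂ) {z : ℂ | z.im < 0}) (nhds Yminus) ∧
    Yplus = Yminus * jumpMatrix N a x
  asymptotics : ∀ i j,
    Asymptotics.IsBigO (Bornology.cobounded ℂ ⊓ Filter.principal {z : ℂ | z.im ≠ 0})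
      (fun z : ℂ => (Y z * Matrix.diagonal
          ![(z ^ (∑ l, n l))⁻¹, z ^ (n 0), z ^ (n 1), z ^ (n 2)]
        - (1 : Matrix (Fin 4) (Fin 4) ℂ)) i j)
      (fun z : ℂ => z⁻¹)

/-- `Ψ(z) = diag (1, 1/c₁, 1/c₂, 1/c₃) Y(z) diag (e^{-N z²/2}, e^{-N a₁ z}, e^{-N a₂ z},
e^{-N a₃ z})`. -/
def Psi (N a : ℝ) (n : Fin 3 → ℕ) (Y : ℂ → Matrix (Fin 4) (Fin 4) ℂ) (z : ℂ) :
    Matrix (Fin 4) (Fin 4) ℂ :=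
  Matrix.diagonal ![1, 1 / cConst N a n 0, 1 / cConst N a n 1, 1 / cConst N a n 2] * Y z *
    Matrix.diagonal
      ![Complex.exp (-N * (z ^ 2 / 2)), Complex.exp (-N * shift a 0 * z),
        Complex.exp (-N * shift a 1 * z), Complex.exp (-N * shift a 2 * z)]

/-- The coefficient matrix `A(z)`. -/
def coeffMatrix (N a : ℝ) (n : Fin 3 → ℕ) (z : ℂ) : Matrix (Fin 4) (Fin 4) ℂ :=
  !![-z, (n 0 : ℂ) / N, (n 1 : ℂ) / N, (n 2 : ℂ) / N;
     -1, -(a : ℂ), 0, 0;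
     -1, 0, 0, 0;
     -1, 0, 0, (a : ℂ)]

end

end MultipleHermite

namespace MultipleHermite

open MeasureTheory Set Filter Topology Polynomial Complex

noncomputable section

section

/-! ### Gaussian integrals of polynomials -/

/-! Everything becomes linear through `raise`, f ↦ f(X - D/N)1, which is the operator exp(-D²/(2N)).
Integration by parts against exp(-N(x²/2 - αx)) turns a factor X - α inside `raise` into a
derivative on the test polynomial. Hence the multiple Hermite polynomials are `raise` of ∏(X -
a_l)^{k_l} (`hermitePoly_eq`), and their norms are explicit (`hNorm_eq`). The Cauchy transform of
`raise N f` times a weight is replaced by a half-line Laplace integral, linear in f and entire in z;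
the two half-lines add up to the full Gaussian integral, which is the jump.

Row i of the solution is then, up to a constant, the value at one polynomial f_i of four linear
functionals F, where f_0 = ∏(X - a_l)^{n_l} and f_l = f_0/(X - a_l). With its exponential factor
included, each functional satisfies F(f)' = -N F(Xf), and z F(f_0) = F(X f_0 + f_0'/N). Since X f_l
= f_0 + a_l f_l and f_0' = ∑ n_l f_l, the differential equation is linear algebra
(`sum_coeffMatrix_mul`). Iterating the multiplication-by-z rule of the Laplace integrals gives the
asymptotics (`pow_mul_cauchyTransform_sub_isBigO`). Uniqueness is Liouville's theorem for Y'Y⁻¹,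
continued across the real line by Morera (`IsRHSolution.eq`). -/

theorem integrable_exp_mul_abs_sub_mul_sq {β : ℝ} (hβ : 0 < β) (b : ℝ) :
    Integrable fun t : ℝ => Real.exp (b * |t| - β * t ^ 2) := by
  have h (c : ℝ) : Integrable fun t : ℝ => Real.exp (c * t - β * t ^ 2) := by
    have := (integrable_cexp_quadratic (b := (β : ℂ)) (by simpa using hβ) c 0).norm
    refine this.congr (.of_forall fun t => ?_)
    simp only [Complex.norm_exp]
    congr 1
    norm_cast
    simp
    ring
  refine ((h b).add (h (-b))).mono' (by fun_prop) (.of_forall fun t => ?_)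
  rw [Real.norm_eq_abs, abs_of_pos (Real.exp_pos _), Pi.add_apply]
  rcases abs_cases t with ⟨h, -⟩ | ⟨h, -⟩ <;> rw [h]
  · linarith [Real.exp_pos (-b * t - β * t ^ 2)]
  · rw [mul_neg, ← neg_mul]
    linarith [Real.exp_pos (b * t - β * t ^ 2)]

/-- Exponential growth is a crude bound for a polynomial, but it is stable under products with
e^{b|t|} and is absorbed by any Gaussian, so it serves every domination argument below. -/
theorem exists_norm_aeval_le_exp (α β : ℂ) (f : ℝ[X]) :
    ∃ C m : ℝ, 0 ≤ m ∧ ∀ t : ℝ, ‖aeval (α + β * t) f‖ ≤ C * Real.exp (m * |t|) := by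
  induction f using Polynomial.induction_on' with
  | add p q hp hq =>
    obtain ⟨C, m, hm, h⟩ := hp
    obtain ⟨C', m', hm', h'⟩ := hq
    refine ⟨|C| + |C'|, m + m', by positivity, fun t => ?_⟩
    rw [map_add, add_mul]
    refine (norm_add_le _ _).trans (add_le_add ((h t).trans ?_) ((h' t).trans ?_))
    · gcongr
      · exact le_abs_self C
      · linarith
    · gcongr
      · exact le_abs_self C'
      · linarith
  | monomial n c =>
    refine ⟨‖c‖ * (‖α‖ + ‖β‖) ^ n, n, by positivity, fun t => ?_⟩
    rw [aeval_monomial, norm_mul, norm_pow, mul_assoc, norm_algebraMap']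
    gcongr
    rw [Real.exp_nat_mul, ← mul_pow]
    gcongr
    refine (norm_add_le _ _).trans ?_
    rw [norm_mul, norm_real, Real.norm_eq_abs, add_mul]
    have h1 : 1 ≤ Real.exp |t| := Real.one_le_exp (abs_nonneg t)
    have h2 : |t| ≤ Real.exp |t| := by linarith [Real.add_one_le_exp |t|]
    gcongr
    nlinarith [norm_nonneg α]

/-! ### Laplace-type integrals of a polynomial against a Gaussian -/

/-- The Gaussian `exp (-t² / (2N) + i t (z - α))`. -/
def gaussKernel (N α : ℝ) (z : ℂ) (t : ℝ) : ℂ :=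
  exp (-(t : ℂ) ^ 2 / (2 * N) + I * t * (z - α))

/-- The integrand `f(α - i t / N) exp (-t² / (2N) + i t (z - α))`. -/
def integrand (N α : ℝ) (f : ℝ[X]) (z : ℂ) (t : ℝ) : ℂ :=
  aeval ((α : ℂ) + -(I / N) * t) f * gaussKernel N α z t

theorem norm_gaussKernel (N α : ℝ) (z : ℂ) (t : ℝ) :
    ‖gaussKernel N α z t‖ = Real.exp (-t * z.im - 1 / (2 * N) * t ^ 2) := by
  rw [gaussKernel, Complex.norm_exp]
  congr 1
  have : (-(t : ℂ) ^ 2 / (2 * N) : ℂ) = ((-t ^ 2 / (2 * N) : ℝ) : ℂ) := by push_cast; ring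
  rw [this, add_re, ofReal_re]
  simp
  ring

theorem exists_norm_integrand_le (N α : ℝ) (f : ℝ[X]) (R : ℝ) :
    ∃ C m : ℝ, ∀ z : ℂ, |z.im| ≤ R → ∀ t : ℝ,
      ‖integrand N α f z t‖ ≤ C * Real.exp (m * |t| - 1 / (2 * N) * t ^ 2) := by
  obtain ⟨C, m, -, h⟩ := exists_norm_aeval_le_exp α (-(I / N)) f
  refine ⟨C, m + R, fun z hz t => ?_⟩
  have hC : 0 ≤ C := by simpa using (norm_nonneg _).trans (h 0)
  rw [integrand, norm_mul, norm_gaussKernel]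
  have : -t * z.im ≤ R * |t| := by
    calc -t * z.im ≤ |-t * z.im| := le_abs_self _
      _ = |z.im| * |t| := by rw [abs_mul, abs_neg, mul_comm]
      _ ≤ R * |t| := by gcongr
  calc _ ≤ C * Real.exp (m * |t|) * Real.exp (R * |t| - 1 / (2 * N) * t ^ 2) := by
        gcongr
        exact h t
    _ = _ := by rw [mul_assoc, ← Real.exp_add]; ring_nf

theorem continuous_integrand (N α : ℝ) (f : ℝ[X]) (z : ℂ) : Continuous (integrand N α f z) := by
  unfold integrand gaussKernel
  have : Continuous fun t : ℝ => aeval ((α : ℂ) + -(I / N) * t) f :=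
    (Polynomial.continuous_aeval f).comp (by fun_prop)
  fun_prop

theorem integrable_integrand {N : ℝ} (hN : 0 < N) (α : ℝ) (f : ℝ[X]) (z : ℂ) :
    Integrable (integrand N α f z) := by
  obtain ⟨C, m, h⟩ := exists_norm_integrand_le N α f |z.im|
  exact ((integrable_exp_mul_abs_sub_mul_sq (by positivity) m).const_mul C).mono'
    (continuous_integrand N α f z).aestronglyMeasurable (.of_forall (h z le_rfl))

theorem integrand_add (N α : ℝ) (f g : ℝ[X]) (z : ℂ) (t : ℝ) :
    integrand N α (f + g) z t = integrand N α f z t + integrand N α g z t := by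
  simp [integrand, add_mul]

theorem integrand_smul (N α c : ℝ) (f : ℝ[X]) (z : ℂ) (t : ℝ) :
    integrand N α (c • f) z t = c • integrand N α f z t := by
  simp [integrand, mul_assoc]

theorem integrand_X_mul (N α : ℝ) (f : ℝ[X]) (z : ℂ) (t : ℝ) :
    integrand N α (X * f) z t = (α - I / N * t) * integrand N α f z t := by
  simp [integrand]
  ring

/-- The integral of `integrand N α f z` over `s`, as a linear function of `f`. -/
def gaussTransform {N : ℝ} (hN : 0 < N) (α : ℝ) (s : Set ℝ) (z : ℂ) : ℝ[X] →ₗ[ℝ] ℂ where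
  toFun f := ∫ t in s, integrand N α f z t
  map_add' f g := by
    simp_rw [integrand_add]
    exact integral_add (integrable_integrand hN α f z).integrableOn
      (integrable_integrand hN α g z).integrableOn
  map_smul' c f := by
    simp_rw [integrand_smul]
    exact integral_smul c _

variable {N : ℝ} (hN : 0 < N) (α : ℝ)

theorem gaussTransform_apply (s : Set ℝ) (z : ℂ) (f : ℝ[X]) :
    gaussTransform hN α s z f = ∫ t in s, integrand N α f z t := rfl

/-- Differentiating in z brings down the factor it = N(α - (α - it/N)), which acts on f as
multiplication by N(α - X). -/
theorem hasDerivAt_gaussTransform (s : Set ℝ) (f : ℝ[X]) (z : ℂ) :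
    HasDerivAt (fun w => gaussTransform hN α s w f)
      (N * (α * gaussTransform hN α s z f - gaussTransform hN α s z (X * f))) z := by
  have hN' : (N : ℂ) ≠ 0 := by exact_mod_cast hN.ne'
  have key (w : ℂ) (t : ℝ) : I * t * integrand N α f w t =
      integrand N α (N • (α • f - X * f)) w t := by
    rw [integrand_smul, sub_eq_add_neg, ← neg_one_smul ℝ (X * f), integrand_add, integrand_smul,
      integrand_smul, integrand_X_mul]
    simp only [real_smul]
    push_cast
    field_simp
    ring
  have hval : (N * (α * gaussTransform hN α s z f - gaussTransform hN α s z (X * f)) : ℂ) =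
      ∫ t in s, I * t * integrand N α f z t := by
    simp_rw [key, ← gaussTransform_apply hN α s z]
    simp
  rw [hval]
  -- The strip of half-width |Im z| + 1 contains the unit ball around z, so one bound dominates all
  -- derivatives there.
  obtain ⟨C, m, hC⟩ := exists_norm_integrand_le N α (N • (α • f - X * f)) (|z.im| + 1)
  refine (hasDerivAt_integral_of_dominated_loc_of_deriv_le (μ := volume.restrict s)
    (F := fun w t => integrand N α f w t)
    (F' := fun w t => I * t * integrand N α f w t)
    (bound := fun t => C * Real.exp (m * |t| - 1 / (2 * N) * t ^ 2))
    (Metric.ball_mem_nhds z one_pos) ?_ ?_ ?_ ?_ ?_ ?_).2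
  · exact .of_forall fun w => (continuous_integrand N α f w).aestronglyMeasurable
  · exact (integrable_integrand hN α f z).integrableOn
  · simp_rw [key]
    exact (continuous_integrand N α _ z).aestronglyMeasurable
  · refine .of_forall fun t w hw => ?_
    simp_rw [key]
    refine hC w ?_ t
    have h1 : |(w - z).im| ≤ 1 :=
      (abs_im_le_norm _).trans (by rw [← dist_eq_norm]; exact (Metric.mem_ball.1 hw).le)
    rw [sub_im] at h1
    have := abs_sub_abs_le_abs_sub w.im z.im
    linarith
  · exact ((integrable_exp_mul_abs_sub_mul_sq (by positivity) m).const_mul C).integrableOn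
  · refine .of_forall fun t w _ => ?_
    unfold integrand gaussKernel
    have h : HasDerivAt (fun w : ℂ => -(t : ℂ) ^ 2 / (2 * N) + I * t * (w - α)) (I * t) w := by
      simpa using (((hasDerivAt_id w).sub_const (α : ℂ)).const_mul (I * (t : ℂ))).const_add
        (-(t : ℂ) ^ 2 / (2 * N))
    exact (h.cexp.const_mul _).congr_deriv (by ring)

/-- The logarithmic t-derivative of the Gaussian is -i((α - it/N) - z), so (X - z)f + f'/N appears
as a total derivative. -/
theorem hasDerivAt_integrand {N : ℝ} (hN : 0 < N) (α : ℝ) (f : ℝ[X]) (z : ℂ) (t : ℝ) :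
    HasDerivAt (integrand N α f z)
      (-I * (integrand N α (X * f + (1 / N) • derivative f) z t - z * integrand N α f z t)) t := by
  have hN' : (N : ℂ) ≠ 0 := by exact_mod_cast hN.ne'
  have h1 : HasDerivAt (fun s : ℂ => -s ^ 2 / (2 * N) + I * s * (z - α))
      (-t / N + I * (z - α)) (t : ℂ) := by
    have := ((((hasDerivAt_id (t : ℂ)).pow 2).neg.div_const (2 * N : ℂ)).add
      (((hasDerivAt_id (t : ℂ)).const_mul I).mul_const (z - α)))
    refine (this.congr_deriv ?_)
    simp
    field_simp
  have h2 : HasDerivAt (fun s : ℂ => aeval ((α : ℂ) + -(I / N) * s) f)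
      (aeval ((α : ℂ) + -(I / N) * t) (derivative f) * (-(I / N))) (t : ℂ) := by
    have h3 : HasDerivAt (fun s : ℂ => (α : ℂ) + -(I / N) * s) (-(I / N)) (t : ℂ) := by
      simpa using ((hasDerivAt_id (t : ℂ)).const_mul (-(I / N))).const_add (α : ℂ)
    exact (Polynomial.hasDerivAt_aeval f _).comp (t : ℂ) h3
  refine ((h2.mul h1.cexp).comp_ofReal).congr_deriv ?_
  rw [integrand_add, integrand_smul, integrand_X_mul]
  simp only [integrand, gaussKernel, real_smul]
  generalize (aeval ((α : ℂ) + -(I / N) * t)) f = u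
  generalize (aeval ((α : ℂ) + -(I / N) * t)) (derivative f) = v
  push_cast
  field_simp
  linear_combination -(t : ℂ) * u * I_sq

theorem integrable_integrand_deriv {N : ℝ} (hN : 0 < N) (α : ℝ) (f : ℝ[X]) (z : ℂ) :
    Integrable fun t => -I *
      (integrand N α (X * f + (1 / N) • derivative f) z t - z * integrand N α f z t) :=
  ((integrable_integrand hN α _ z).sub ((integrable_integrand hN α f z).const_mul z)).const_mul _

theorem integrand_zero (N α : ℝ) (f : ℝ[X]) (z : ℂ) : integrand N α f z 0 = (f.eval α : ℝ) := by
  have : aeval (α : ℂ) f = ((f.eval α : ℝ) : ℂ) := by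
    simpa using (Polynomial.aeval_algebraMap_apply_eq_algebraMap_eval α f (A := ℂ))
  simp [integrand, gaussKernel, this]

theorem setIntegral_integrand_deriv (s : Set ℝ) (f : ℝ[X]) (z : ℂ) :
    ∫ t in s, -I *
      (integrand N α (X * f + (1 / N) • derivative f) z t - z * integrand N α f z t) =
    -I * (gaussTransform hN α s z (X * f + (1 / N) • derivative f) -
      z * gaussTransform hN α s z f) := by
  rw [integral_const_mul, integral_sub (integrable_integrand hN α _ z).integrableOn
    ((integrable_integrand hN α f z).const_mul z).integrableOn, integral_const_mul]
  rfl

/-- The total derivative is integrated over the half-line; the only boundary contribution is f(α),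
at t = 0. -/
theorem mul_gaussTransform_Ioi (f : ℝ[X]) (z : ℂ) :
    z * gaussTransform hN α (Ioi 0) z f =
      gaussTransform hN α (Ioi 0) z (X * f + (1 / N) • derivative f) + I * (f.eval α : ℝ) := by
  have hint := integrable_integrand_deriv hN α f z
  have h := integral_Ioi_of_hasDerivAt_of_tendsto' (a := 0)
    (fun t _ => hasDerivAt_integrand hN α f z t) hint.integrableOn
    (tendsto_zero_of_hasDerivAt_of_integrableOn_Ioi (a := 0)
      (fun t _ => hasDerivAt_integrand hN α f z t) hint.integrableOn
      (integrable_integrand hN α f z).integrableOn)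
  rw [setIntegral_integrand_deriv hN, integrand_zero] at h
  linear_combination (-I) * h + (z * gaussTransform hN α (Ioi 0) z f -
    gaussTransform hN α (Ioi 0) z (X * f + (1 / N) • derivative f)) * I_sq

theorem mul_gaussTransform_Iic (f : ℝ[X]) (z : ℂ) :
    z * gaussTransform hN α (Iic 0) z f =
      gaussTransform hN α (Iic 0) z (X * f + (1 / N) • derivative f) - I * (f.eval α : ℝ) := by
  have hint := integrable_integrand_deriv hN α f z
  have h := integral_Iic_of_hasDerivAt_of_tendsto' (a := 0)
    (fun t _ => hasDerivAt_integrand hN α f z t) hint.integrableOn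
    (tendsto_zero_of_hasDerivAt_of_integrableOn_Iic (a := 0)
      (fun t _ => hasDerivAt_integrand hN α f z t) hint.integrableOn
      (integrable_integrand hN α f z).integrableOn)
  rw [setIntegral_integrand_deriv hN, integrand_zero] at h
  linear_combination (-I) * h + (z * gaussTransform hN α (Iic 0) z f -
    gaussTransform hN α (Iic 0) z (X * f + (1 / N) • derivative f)) * I_sq

theorem gaussTransform_Iic_add_Ioi (f : ℝ[X]) (z : ℂ) :
    gaussTransform hN α (Iic 0) z f + gaussTransform hN α (Ioi 0) z f =
      gaussTransform hN α univ z f := by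
  simp only [gaussTransform_apply]
  rw [← setIntegral_union (Iic_disjoint_Ioi le_rfl) measurableSet_Ioi
    (integrable_integrand hN α f z).integrableOn (integrable_integrand hN α f z).integrableOn,
    Iic_union_Ioi]

/-- On the matching half-plane |e^{itz}| ≤ 1, so the bound is uniform up to the real line. This is
what makes the later expansions in 1/z hold in all directions. -/
theorem exists_norm_gaussTransform_le (f : ℝ[X]) : ∃ C : ℝ, ∀ z : ℂ,
    (0 ≤ z.im → ‖gaussTransform hN α (Ioi 0) z f‖ ≤ C) ∧
    (z.im ≤ 0 → ‖gaussTransform hN α (Iic 0) z f‖ ≤ C) := by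
  have hint := (integrable_integrand hN α f 0).norm
  have hle {z : ℂ} {t : ℝ} (h : 0 ≤ t * z.im) :
      ‖integrand N α f z t‖ ≤ ‖integrand N α f 0 t‖ := by
    rw [integrand, integrand, norm_mul, norm_mul, norm_gaussKernel, norm_gaussKernel, zero_im]
    exact mul_le_mul_of_nonneg_left (Real.exp_le_exp.2 (by linarith)) (norm_nonneg _)
  refine ⟨∫ t, ‖integrand N α f 0 t‖, fun z => ⟨fun hz => ?_, fun hz => ?_⟩⟩
  · refine (norm_integral_le_integral_norm _).trans (le_trans ?_
      (setIntegral_le_integral hint (.of_forall fun _ => norm_nonneg _) (s := Ioi 0)))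
    refine setIntegral_mono_on (integrable_integrand hN α f z).norm.integrableOn
      hint.integrableOn measurableSet_Ioi fun t ht => hle (mul_nonneg (le_of_lt ht) hz)
  · refine (norm_integral_le_integral_norm _).trans (le_trans ?_
      (setIntegral_le_integral hint (.of_forall fun _ => norm_nonneg _) (s := Iic 0)))
    refine setIntegral_mono_on (integrable_integrand hN α f z).norm.integrableOn
      hint.integrableOn measurableSet_Iic fun t ht => hle (mul_nonneg_of_nonpos_of_nonpos ht hz)

end

section

/-! ### The raising operator and Gaussian moments -/

theorem polynomial_induction_X_mul {p : ℝ[X] → Prop} (hC : ∀ c, p (C c))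
    (hadd : ∀ f g, p f → p g → p (f + g)) (hX : ∀ f, p f → p (X * f)) (f : ℝ[X]) : p f := by
  refine f.induction_on hC hadd fun n c h => ?_
  rw [pow_succ, ← mul_assoc, mul_comm]
  exact hX _ h

/-- `f ↦ f(X - D / N) 1`, where `D` is the derivative. -/
def raise (N : ℝ) : ℝ[X] →ₗ[ℝ] ℝ[X] :=
  LinearMap.applyₗ 1 ∘ₗ
    (aeval (LinearMap.mulLeft ℝ (X : ℝ[X]) - (1 / N) • derivative : Module.End ℝ ℝ[X])).toLinearMap

theorem raise_C (N c : ℝ) : raise N (C c) = C c := by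
  simp [raise, Algebra.algebraMap_eq_smul_one, smul_eq_C_mul]

theorem raise_X_mul (N : ℝ) (f : ℝ[X]) :
    raise N (X * f) = X * raise N f - (1 / N) • derivative (raise N f) := by
  simp [raise]

/-- D commutes with X - D/N up to the identity and kills 1, just as D does with X. -/
theorem derivative_raise (N : ℝ) (f : ℝ[X]) :
    derivative (raise N f) = raise N (derivative f) := by
  induction f using polynomial_induction_X_mul with
  | hC c => simp [raise_C]
  | hadd f g hf hg => simp [hf, hg]
  | hX f hf =>
    simp only [raise_X_mul, derivative_mul, derivative_X, map_add, map_sub, derivative_smul, hf,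
      one_mul]
    ring

theorem X_mul_raise (N : ℝ) (f : ℝ[X]) :
    X * raise N f = raise N (X * f + (1 / N) • derivative f) := by
  rw [map_add, map_smul, raise_X_mul, derivative_raise, sub_add_cancel]

/-- `raise N` is exp(-D²/(2N)), whose inverse is obtained by changing the sign of N. -/
theorem raise_neg_raise (N : ℝ) (f : ℝ[X]) : raise (-N) (raise N f) = f := by
  induction f using polynomial_induction_X_mul with
  | hC c => simp [raise_C]
  | hadd f g hf hg => simp [hf, hg]
  | hX f hf =>
    rw [raise_X_mul, map_sub, map_smul, raise_X_mul, ← derivative_raise, hf, div_neg, neg_smul,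
      sub_neg_eq_add, add_sub_cancel_right]

theorem raise_coeff_of_natDegree_le (N : ℝ) (n : ℕ) : ∀ f : ℝ[X], f.natDegree ≤ n →
    (raise N f).natDegree ≤ n ∧ (raise N f).coeff n = f.coeff n := by
  induction n with
  | zero =>
    intro f hf
    rw [natDegree_eq_zero.1 (Nat.le_zero.1 hf) |>.choose_spec.symm, raise_C]
    simp
  | succ n ih =>
    intro f hf
    have hd : f.divX.natDegree ≤ n := by rw [natDegree_divX_eq_natDegree_tsub_one]; omega
    obtain ⟨h1, h2⟩ := ih _ hd
    have hder : (derivative (raise N f.divX)).natDegree ≤ n :=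
      (natDegree_derivative_le _).trans (by omega)
    have e : raise N f = X * raise N f.divX - (1 / N) • derivative (raise N f.divX) +
        C (f.coeff 0) := by
      conv_lhs => rw [← X_mul_divX_add f]
      rw [map_add, raise_X_mul, raise_C]
    constructor
    · rw [e]
      refine natDegree_add_le_of_degree_le ((natDegree_sub_le _ _).trans (max_le ?_ ?_)) (by simp)
      · exact natDegree_mul_le.trans (by rw [natDegree_X]; omega)
      · exact (natDegree_smul_le _ _).trans (by omega)
    · rw [e, coeff_add, coeff_sub, coeff_X_mul, h2, coeff_smul,
        coeff_eq_zero_of_natDegree_lt (Nat.lt_succ_of_le hder), coeff_C_succ, coeff_divX]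
      simp

theorem raise_monic {f : ℝ[X]} (hf : f.Monic) (N : ℝ) :
    (raise N f).Monic ∧ (raise N f).natDegree = f.natDegree := by
  obtain ⟨h1, h2⟩ := raise_coeff_of_natDegree_le N _ f le_rfl
  rw [hf.coeff_natDegree] at h2
  exact ⟨monic_of_natDegree_le_of_coeff_eq_one _ h1 h2,
    natDegree_eq_of_le_of_coeff_ne_zero h1 (by simp [h2])⟩

/-! ### Gaussian moments of raised polynomials -/

/-- The weight `exp (-N (x² / 2 - α x))`. -/
def gaussWeight (N α x : ℝ) : ℝ := Real.exp (-N * (x ^ 2 / 2 - α * x))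

theorem integrable_eval_mul_gaussWeight {N : ℝ} (hN : 0 < N) (α : ℝ) (f : ℝ[X]) :
    Integrable fun x => f.eval x * gaussWeight N α x := by
  obtain ⟨C, m, -, h⟩ := exists_norm_aeval_le_exp 0 1 f
  have hC : 0 ≤ C := by simpa using (norm_nonneg _).trans (h 0)
  refine ((integrable_exp_mul_abs_sub_mul_sq (half_pos hN) (m + N * |α|)).const_mul C).mono'
    (by unfold gaussWeight; fun_prop) (.of_forall fun x => ?_)
  have h1 : ‖f.eval x‖ ≤ C * Real.exp (m * |x|) := by
    have := h x
    rwa [zero_add, one_mul, show (x : ℂ) = algebraMap ℝ ℂ x from rfl,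
      aeval_algebraMap_apply_eq_algebraMap_eval, norm_algebraMap'] at this
  rw [norm_mul, gaussWeight, Real.norm_eq_abs (Real.exp _), abs_of_pos (Real.exp_pos _)]
  calc _ ≤ C * Real.exp (m * |x|) * Real.exp (N * |α| * |x| - N / 2 * x ^ 2) := by
        gcongr
        have := mul_le_mul_of_nonneg_left ((le_abs_self (α * x)).trans (abs_mul α x).le) hN.le
        linarith
    _ = _ := by rw [mul_assoc, ← Real.exp_add]; ring_nf

/-- The moment functional `f ↦ ∫ f(x) exp (-N (x² / 2 - α x)) dx`. -/
def gaussMoment {N : ℝ} (hN : 0 < N) (α : ℝ) : ℝ[X] →ₗ[ℝ] ℝ where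
  toFun f := ∫ x, f.eval x * gaussWeight N α x
  map_add' f g := by
    simp_rw [eval_add, add_mul]
    exact integral_add (integrable_eval_mul_gaussWeight hN α f)
      (integrable_eval_mul_gaussWeight hN α g)
  map_smul' c f := by
    simp_rw [eval_smul, smul_eq_mul, mul_assoc]
    exact integral_const_mul c _

variable {N : ℝ} (hN : 0 < N) (α : ℝ)

theorem gaussMoment_apply (f : ℝ[X]) :
    gaussMoment hN α f = ∫ x, f.eval x * gaussWeight N α x := rfl

theorem gaussMoment_one : gaussMoment hN α 1 =
    Real.sqrt (2 * Real.pi / N) * Real.exp (N * α ^ 2 / 2) := by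
  have h (x : ℝ) : (1 : ℝ[X]).eval x * gaussWeight N α x =
      Real.exp (-(N / 2) * (x - α) ^ 2) * Real.exp (N * α ^ 2 / 2) := by
    rw [eval_one, one_mul, gaussWeight, ← Real.exp_add]
    ring_nf
  simp_rw [gaussMoment_apply, h]
  rw [integral_mul_const, integral_sub_right_eq_self (fun x => Real.exp (-(N / 2) * x ^ 2)) α,
    integral_gaussian]
  congr 2
  field_simp

theorem gaussMoment_one_pos : 0 < gaussMoment hN α 1 := by
  rw [gaussMoment_one]
  positivity

theorem gaussMoment_derivative (f : ℝ[X]) :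
    gaussMoment hN α (derivative f) = N * gaussMoment hN α ((X - C α) * f) := by
  have hw (x : ℝ) : HasDerivAt (gaussWeight N α) (-N * (x - α) * gaussWeight N α x) x := by
    have h1 : HasDerivAt (fun x : ℝ => -N * (x ^ 2 / 2 - α * x)) (-N * (x - α)) x := by
      have := (((hasDerivAt_id x).pow 2).div_const 2 |>.sub
        ((hasDerivAt_id x).const_mul α)).const_mul (-N)
      refine this.congr_deriv ?_
      simp
    exact h1.exp.congr_deriv (by rw [gaussWeight]; ring)
  have hd (x : ℝ) : HasDerivAt (fun x => f.eval x * gaussWeight N α x)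
      ((derivative f - N • ((X - C α) * f)).eval x * gaussWeight N α x) x := by
    refine ((f.hasDerivAt x).mul (hw x)).congr_deriv ?_
    simp
    ring
  have := integral_eq_zero_of_hasDerivAt_of_integrable hd
    (integrable_eval_mul_gaussWeight hN α _) (integrable_eval_mul_gaussWeight hN α f)
  rw [← gaussMoment_apply hN, map_sub, map_smul, smul_eq_mul] at this
  linarith

/-- `raise` makes multiplication by X - α adjoint to N⁻¹D: the difference of the two sides is the
moment of (X - α)g - g'/N with g = `raise N f * q`, which vanishes by integration by parts.
Orthogonality follows, since enough derivatives kill X^l. -/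
theorem gaussMoment_raise_X_sub_C_mul (f q : ℝ[X]) :
    gaussMoment hN α (raise N ((X - C α) * f) * q) =
      N⁻¹ * gaussMoment hN α (raise N f * derivative q) := by
  have e : raise N ((X - C α) * f) * q = (X - C α) * (raise N f * q) -
      N⁻¹ • derivative (raise N f * q) + N⁻¹ • (raise N f * derivative q) := by
    rw [sub_mul, map_sub, raise_X_mul, ← smul_eq_C_mul, map_smul, derivative_mul]
    simp only [smul_eq_C_mul, one_div]
    ring
  rw [e, map_add, map_sub, map_smul, map_smul, gaussMoment_derivative]
  simp only [smul_eq_mul]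
  field_simp
  ring

theorem gaussMoment_raise_X_sub_C_pow_mul (m : ℕ) (f q : ℝ[X]) :
    gaussMoment hN α (raise N ((X - C α) ^ m * f) * q) =
      N⁻¹ ^ m * gaussMoment hN α (raise N f * derivative^[m] q) := by
  induction m generalizing q with
  | zero => simp
  | succ m ih =>
    rw [pow_succ', mul_assoc, gaussMoment_raise_X_sub_C_mul, ih, Function.iterate_succ_apply]
    ring

theorem gaussMoment_raise (f : ℝ[X]) :
    gaussMoment hN α (raise N f) = f.eval α * gaussMoment hN α 1 := by
  obtain ⟨g, hg⟩ := X_sub_C_dvd_sub_C_eval (a := α) (p := f)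
  have h := gaussMoment_raise_X_sub_C_mul hN α g 1
  rw [← hg, map_sub, raise_C] at h
  simp only [mul_one, derivative_one, mul_zero, map_zero, map_sub] at h
  rw [← mul_one (C _), ← smul_eq_C_mul, map_smul, smul_eq_mul] at h
  linarith

theorem gaussMoment_raise_X_sub_C_pow_mul_X_pow_self (m : ℕ) (f : ℝ[X]) :
    gaussMoment hN α (raise N ((X - C α) ^ m * f) * X ^ m) =
      N⁻¹ ^ m * m.factorial * f.eval α * gaussMoment hN α 1 := by
  rw [gaussMoment_raise_X_sub_C_pow_mul, iterate_derivative_X_pow_eq_smul, Nat.descFactorial_self]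
  simp only [tsub_self, pow_zero, mul_smul_comm, mul_one, map_smul, gaussMoment_raise,
    smul_eq_mul]
  ring

theorem gaussMoment_raise_X_sub_C_pow_mul_X_pow_of_lt {m l : ℕ} (h : l < m) (f : ℝ[X]) :
    gaussMoment hN α (raise N ((X - C α) ^ m * f) * X ^ l) = 0 := by
  rw [gaussMoment_raise_X_sub_C_pow_mul, iterate_derivative_eq_zero (by simpa using h)]
  simp

/-! ### Explicit form and uniqueness of the multiple Hermite polynomials -/

/-- `∏ l, (X - a_l) ^ k_l`. -/
def shiftPoly (a : ℝ) (k : Fin 3 → ℕ) : ℝ[X] := ∏ l, (X - C (shift a l)) ^ k l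

theorem monic_shiftPoly (a : ℝ) (k : Fin 3 → ℕ) : (shiftPoly a k).Monic :=
  monic_prod_of_monic _ _ fun _ _ => (monic_X_sub_C _).pow _

theorem natDegree_shiftPoly (a : ℝ) (k : Fin 3 → ℕ) : (shiftPoly a k).natDegree = ∑ l, k l := by
  rw [shiftPoly, natDegree_prod_of_monic _ _ fun l _ => (monic_X_sub_C _).pow _]
  simp

theorem shift_injective {a : ℝ} (ha : a ≠ 0) : Function.Injective (shift a) := by
  intro i j h
  fin_cases i <;> fin_cases j <;> simp_all [shift, self_eq_neg, neg_eq_self]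

/-- `∏ l ≠ j, (X - a_l) ^ k_l`. -/
def shiftCofactor (a : ℝ) (k : Fin 3 → ℕ) (j : Fin 3) : ℝ[X] :=
  ∏ l ∈ Finset.univ.erase j, (X - C (shift a l)) ^ k l

theorem shiftPoly_eq_pow_mul (a : ℝ) (k : Fin 3 → ℕ) (j : Fin 3) :
    shiftPoly a k = (X - C (shift a j)) ^ k j * shiftCofactor a k j :=
  (Finset.mul_prod_erase _ _ (Finset.mem_univ j)).symm

theorem eval_shiftCofactor_ne_zero {a : ℝ} (ha : a ≠ 0) (k : Fin 3 → ℕ) (j : Fin 3) :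
    (shiftCofactor a k j).eval (shift a j) ≠ 0 := by
  rw [shiftCofactor, eval_prod, Finset.prod_ne_zero_iff]
  intro l hl
  simpa using fun h : shift a j - shift a l = 0 =>
    absurd (shift_injective ha (sub_eq_zero.1 h)).symm (Finset.ne_of_mem_erase hl)

theorem integral_eval_mul_pow_mul_weight (a : ℝ) (P : ℝ[X]) (m : ℕ) (j : Fin 3) :
    ∫ x : ℝ, P.eval x * x ^ m * weight N a j x = gaussMoment hN (shift a j) (P * X ^ m) := by
  simp only [gaussMoment_apply, eval_mul, eval_pow, eval_X]
  rfl

theorem isMultipleOrthogonal_raise_shiftPoly (hN : 0 < N) (a : ℝ) (k : Fin 3 → ℕ) :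
    IsMultipleOrthogonal N a k (raise N (shiftPoly a k)) := by
  obtain ⟨h1, h2⟩ := raise_monic (monic_shiftPoly a k) N
  refine ⟨h1, h2.trans (natDegree_shiftPoly a k), fun j m hm => ?_⟩
  rw [integral_eval_mul_pow_mul_weight hN, shiftPoly_eq_pow_mul a k j]
  exact gaussMoment_raise_X_sub_C_pow_mul_X_pow_of_lt hN _ hm _

/-- Once (X - α)^m divides f, the m-th moment is a nonzero multiple of the cofactor's value at α, so
its vanishing yields one more factor. -/
theorem X_sub_C_pow_dvd_of_gaussMoment_eq_zero (f : ℝ[X]) (m : ℕ)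
    (h : ∀ l < m, gaussMoment hN α (raise N f * X ^ l) = 0) : (X - C α) ^ m ∣ f := by
  induction m with
  | zero => simp
  | succ m ih =>
    obtain ⟨g, rfl⟩ := ih fun l hl => h l (hl.trans m.lt_succ_self)
    have h0 := h m m.lt_succ_self
    rw [gaussMoment_raise_X_sub_C_pow_mul_X_pow_self] at h0
    have : g.eval α = 0 := by
      simpa [hN.ne', Nat.factorial_ne_zero, (gaussMoment_one_pos hN α).ne'] using h0
    rw [pow_succ]
    exact mul_dvd_mul_left _ (dvd_iff_isRoot.2 this)

/-- Undo `raise` on P: orthogonality to each weight forces the power of X - a_j, distinct shifts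
make these powers coprime, and monicity with equal degree leaves no further factor. -/
theorem IsMultipleOrthogonal.eq_raise_shiftPoly (hN : 0 < N) {a : ℝ} (ha : a ≠ 0)
    {k : Fin 3 → ℕ} {P : ℝ[X]} (hP : IsMultipleOrthogonal N a k P) :
    P = raise N (shiftPoly a k) := by
  obtain ⟨hm, hdeg, horth⟩ := hP
  have hinv : raise N (raise (-N) P) = P := by simpa using raise_neg_raise (-N) P
  obtain ⟨h1, h2⟩ := raise_monic hm (-N)
  have hdvd : shiftPoly a k ∣ raise (-N) P := by
    refine Finset.prod_dvd_of_coprime (fun i _ j _ hij => ?_) fun j _ => ?_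
    · exact (isCoprime_X_sub_C_of_isUnit_sub
        (sub_ne_zero.2 fun h => hij (shift_injective ha h)).isUnit).pow
    · refine X_sub_C_pow_dvd_of_gaussMoment_eq_zero hN _ _ _ fun l hl => ?_
      rw [hinv, ← integral_eval_mul_pow_mul_weight hN]
      exact horth j l hl
  have := eq_of_monic_of_dvd_of_natDegree_le (monic_shiftPoly a k) h1 hdvd
    (by rw [h2, hdeg, natDegree_shiftPoly])
  rw [← hinv, this]

theorem hermitePoly_eq (hN : 0 < N) {a : ℝ} (ha : a ≠ 0) (k : Fin 3 → ℕ) :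
    hermitePoly N a k = raise N (shiftPoly a k) := by
  have h : ∃ P, IsMultipleOrthogonal N a k P := ⟨_, isMultipleOrthogonal_raise_shiftPoly hN a k⟩
  rw [hermitePoly, dif_pos h]
  exact h.choose_spec.eq_raise_shiftPoly hN ha

theorem hNorm_eq {a : ℝ} (ha : a ≠ 0) (k : Fin 3 → ℕ) (j : Fin 3) :
    hNorm N a k j = N⁻¹ ^ k j * (k j).factorial * (shiftCofactor a k j).eval (shift a j) *
      gaussMoment hN (shift a j) 1 := by
  rw [hNorm, hermitePoly_eq hN ha, integral_eval_mul_pow_mul_weight hN,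
    shiftPoly_eq_pow_mul a k j, gaussMoment_raise_X_sub_C_pow_mul_X_pow_self]

/-! ### The Cauchy transform -/

/-- The weight `exp (-N (z² / 2 - α z))` at complex arguments. -/
def cgaussWeight (N α : ℝ) (z : ℂ) : ℂ := exp (-N * (z ^ 2 / 2 - α * z))

theorem hasDerivAt_cgaussWeight (N α : ℝ) (z : ℂ) :
    HasDerivAt (cgaussWeight N α) (-N * (z - α) * cgaussWeight N α z) z := by
  have h1 : HasDerivAt (fun z : ℂ => -N * (z ^ 2 / 2 - α * z)) (-N * (z - α)) z := by
    have := (((hasDerivAt_id z).pow 2).div_const 2 |>.sub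
      ((hasDerivAt_id z).const_mul (α : ℂ))).const_mul (-N : ℂ)
    refine this.congr_deriv ?_
    simp
  exact h1.cexp.congr_deriv (by rw [cgaussWeight]; ring)

theorem gaussTransform_univ_one (z : ℂ) :
    gaussMoment hN α 1 / (2 * Real.pi) * gaussTransform hN α univ z 1 = cgaussWeight N α z := by
  have hN' : (N : ℂ) ≠ 0 := by exact_mod_cast hN.ne'
  have h : ∀ t : ℝ, integrand N α 1 z t =
      exp ((-1 / (2 * N) : ℂ) * t ^ 2 + I * (z - α) * t + 0) := by
    intro t
    rw [integrand, map_one, one_mul, gaussKernel]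
    ring_nf
  have hb : (-1 / (2 * N) : ℂ).re < 0 := by
    have : (-1 / (2 * N) : ℂ) = ((-1 / (2 * N) : ℝ) : ℂ) := by push_cast; rfl
    rw [this, ofReal_re]
    exact div_neg_of_neg_of_pos (by norm_num) (by positivity)
  have hs : (Real.pi / -(-1 / (2 * N)) : ℂ) ^ (1 / 2 : ℂ) = (Real.sqrt (2 * Real.pi * N) : ℝ) := by
    rw [Real.sqrt_eq_rpow, ofReal_cpow (by positivity)]
    congr 1
    · push_cast; field_simp
    · norm_num
  rw [gaussTransform_apply, setIntegral_univ, integral_congr_ae (.of_forall h),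
    integral_cexp_quadratic hb, hs, gaussMoment_one, cgaussWeight]
  have h3 : Real.sqrt (2 * Real.pi / N) * Real.sqrt (2 * Real.pi * N) = 2 * Real.pi := by
    rw [← Real.sqrt_mul (by positivity), ← Real.sqrt_sq (by positivity : 0 ≤ 2 * Real.pi)]
    congr 1
    rw [Real.sqrt_sq (by positivity)]
    field_simp
  have h4 : (Real.sqrt (2 * Real.pi / N) : ℂ) * Real.sqrt (2 * Real.pi * N) = 2 * Real.pi := by
    exact_mod_cast h3
  have h5 : (Real.pi : ℂ) ≠ 0 := by exact_mod_cast Real.pi_ne_zero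
  push_cast
  have h6 : exp (-N * (z ^ 2 / 2 - α * z)) = exp (N * α ^ 2 / 2) *
      exp (0 - (I * (z - α)) ^ 2 / (4 * (-1 / (2 * N)))) := by
    rw [← exp_add]
    congr 1
    field_simp
    linear_combination (-4 * N : ℂ) * (z - α) ^ 2 * I_sq
  rw [h6]
  generalize exp (0 - (I * (z - α)) ^ 2 / (4 * (-1 / (2 * N)))) = u
  field_simp
  linear_combination u * h4

/-- The case f = 1 is the Fourier transform of a Gaussian. Both sides have z-derivatives that
express the value at Xf through the value at f, so the identity propagates from f to Xf. -/
theorem gaussTransform_univ (f : ℝ[X]) (z : ℂ) :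
    gaussMoment hN α 1 / (2 * Real.pi) * gaussTransform hN α univ z f =
      aeval z (raise N f) * cgaussWeight N α z := by
  have hN' : (N : ℂ) ≠ 0 := by exact_mod_cast hN.ne'
  induction f using polynomial_induction_X_mul generalizing z with
  | hC c =>
    rw [raise_C, ← mul_one (C c), ← smul_eq_C_mul, map_smul, map_smul,
      ← gaussTransform_univ_one hN α z]
    simp
    ring
  | hadd f g hf hg => rw [map_add, map_add, map_add, mul_add, hf, hg, add_mul]
  | hX f hf =>
    have h1 := (hasDerivAt_gaussTransform hN α univ f z).const_mul
      (gaussMoment hN α 1 / (2 * Real.pi) : ℂ)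
    -- The induction hypothesis holds for all z, so it may be differentiated; uniqueness of the
    -- derivative then gives the case Xf.
    rw [funext hf] at h1
    have h2 := h1.unique (((raise N f).hasDerivAt_aeval z).mul (hasDerivAt_cgaussWeight N α z))
    rw [raise_X_mul, map_sub, map_mul (aeval z), aeval_X, map_smul (aeval z), real_smul]
    have h3 := hf z
    generalize (gaussMoment hN α 1 / (2 * Real.pi) : ℂ) = κ at h2 h3 ⊢
    push_cast
    field_simp
    linear_combination (-1 : ℂ) * h2 + α * N * h3

/-- The Cauchy transform `(2πi)⁻¹ ∫ (raise N f)(x) exp (-N (x² / 2 - α x)) / (x - z) dx`,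
written as a Laplace integral in each of the half-planes. -/
def cauchyTransform (z : ℂ) : ℝ[X] →ₗ[ℝ] ℂ :=
  if 0 < z.im then (gaussMoment hN α 1 / (2 * Real.pi)) • gaussTransform hN α (Ioi 0) z
  else -(gaussMoment hN α 1 / (2 * Real.pi)) • gaussTransform hN α (Iic 0) z

theorem cauchyTransform_of_im_pos {z : ℂ} (hz : 0 < z.im) (f : ℝ[X]) :
    cauchyTransform hN α z f =
      gaussMoment hN α 1 / (2 * Real.pi) * gaussTransform hN α (Ioi 0) z f := by
  simp [cauchyTransform, hz]

theorem cauchyTransform_of_im_neg {z : ℂ} (hz : z.im < 0) (f : ℝ[X]) :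
    cauchyTransform hN α z f =
      -(gaussMoment hN α 1 / (2 * Real.pi)) * gaussTransform hN α (Iic 0) z f := by
  simp [cauchyTransform, hz.not_gt]

theorem hasDerivAt_cauchyTransform (f : ℝ[X]) {z : ℂ} (hz : z.im ≠ 0) :
    HasDerivAt (fun w => cauchyTransform hN α w f)
      (N * (α * cauchyTransform hN α z f - cauchyTransform hN α z (X * f))) z := by
  rcases hz.lt_or_gt with h | h
  · have he : ∀ᶠ w in 𝓝 z, w.im < 0 := continuous_im.continuousAt.eventually_lt_const h
    refine (((hasDerivAt_gaussTransform hN α (Iic 0) f z).const_mul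
      (-(gaussMoment hN α 1 / (2 * Real.pi)) : ℂ)).congr_of_eventuallyEq
      (he.mono fun w hw => cauchyTransform_of_im_neg hN α hw f)).congr_deriv ?_
    rw [cauchyTransform_of_im_neg hN α h, cauchyTransform_of_im_neg hN α h]
    ring
  · have he : ∀ᶠ w in 𝓝 z, 0 < w.im := continuous_im.continuousAt.eventually_const_lt h
    refine (((hasDerivAt_gaussTransform hN α (Ioi 0) f z).const_mul
      (gaussMoment hN α 1 / (2 * Real.pi) : ℂ)).congr_of_eventuallyEq
      (he.mono fun w hw => cauchyTransform_of_im_pos hN α hw f)).congr_deriv ?_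
    rw [cauchyTransform_of_im_pos hN α h, cauchyTransform_of_im_pos hN α h]
    ring

theorem mul_cauchyTransform (f : ℝ[X]) {z : ℂ} (hz : z.im ≠ 0) :
    z * cauchyTransform hN α z f = cauchyTransform hN α z (X * f + (1 / N) • derivative f) +
      gaussMoment hN α 1 / (2 * Real.pi) * I * (f.eval α : ℝ) := by
  rcases hz.lt_or_gt with h | h
  · rw [cauchyTransform_of_im_neg hN α h, cauchyTransform_of_im_neg hN α h, mul_left_comm,
      mul_gaussTransform_Iic]
    ring
  · rw [cauchyTransform_of_im_pos hN α h, cauchyTransform_of_im_pos hN α h, mul_left_comm,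
      mul_gaussTransform_Ioi]
    ring

theorem exists_norm_cauchyTransform_le (f : ℝ[X]) :
    ∃ C : ℝ, ∀ z : ℂ, z.im ≠ 0 → ‖cauchyTransform hN α z f‖ ≤ C := by
  obtain ⟨C, hC⟩ := exists_norm_gaussTransform_le hN α f
  refine ⟨‖(gaussMoment hN α 1 / (2 * Real.pi) : ℂ)‖ * C, fun z hz => ?_⟩
  rcases hz.lt_or_gt with h | h
  · rw [cauchyTransform_of_im_neg hN α h, norm_mul, norm_neg]
    gcongr
    exact (hC z).2 h.le
  · rw [cauchyTransform_of_im_pos hN α h, norm_mul]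
    gcongr
    exact (hC z).1 h.le

/-- Both half-line transforms are entire, so the boundary values exist at once, and their difference
is the full-line transform. -/
theorem exists_tendsto_cauchyTransform (f : ℝ[X]) (x : ℝ) : ∃ u v : ℂ,
    Tendsto (fun z => cauchyTransform hN α z f) (𝓝[{z | 0 < z.im}] (x : ℂ)) (𝓝 u) ∧
    Tendsto (fun z => cauchyTransform hN α z f) (𝓝[{z | z.im < 0}] (x : ℂ)) (𝓝 v) ∧
    u = v + aeval (x : ℂ) (raise N f) * cgaussWeight N α x := by
  have hc (s : Set ℝ) : Continuous fun z => gaussTransform hN α s z f :=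
    continuous_iff_continuousAt.2 fun z => (hasDerivAt_gaussTransform hN α s f z).continuousAt
  refine ⟨_, _, ((((hc (Ioi 0)).const_mul (gaussMoment hN α 1 / (2 * Real.pi) : ℂ)).tendsto
    (x : ℂ)).mono_left nhdsWithin_le_nhds).congr' ?_,
    ((((hc (Iic 0)).const_mul (-(gaussMoment hN α 1 / (2 * Real.pi)) : ℂ)).tendsto
    (x : ℂ)).mono_left nhdsWithin_le_nhds).congr' ?_, ?_⟩
  · filter_upwards [self_mem_nhdsWithin] with z hz
    exact (cauchyTransform_of_im_pos hN α hz f).symm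
  · filter_upwards [self_mem_nhdsWithin] with z hz
    exact (cauchyTransform_of_im_neg hN α hz f).symm
  · rw [← gaussTransform_univ hN, ← gaussTransform_Iic_add_Ioi]
    ring

/-! ### Asymptotics at infinity off the real axis -/

/-- The filter of points of `ℂ \ ℝ` tending to infinity. -/
abbrev offRealAtInfinity : Filter ℂ := Bornology.cobounded ℂ ⊓ 𝓟 {z : ℂ | z.im ≠ 0}

theorem eventually_im_ne_zero : ∀ᶠ z in offRealAtInfinity, z.im ≠ 0 :=
  mem_inf_of_right (mem_principal_self _)

theorem eventually_ne_zero_offRealAtInfinity : ∀ᶠ z in offRealAtInfinity, z ≠ 0 :=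
  eventually_im_ne_zero.mono fun z hz h => hz (by simp [h])

theorem cauchyTransform_isBigO_one (f : ℝ[X]) :
    (fun z => cauchyTransform hN α z f) =O[offRealAtInfinity] fun _ => (1 : ℂ) := by
  obtain ⟨C, hC⟩ := exists_norm_cauchyTransform_le hN α f
  refine Asymptotics.IsBigO.of_bound C (eventually_im_ne_zero.mono fun z hz => ?_)
  simpa using hC z hz

theorem cauchyTransform_isBigO_inv (f : ℝ[X]) :
    (fun z => cauchyTransform hN α z f) =O[offRealAtInfinity] fun z => z⁻¹ := by
  have h : (fun z => z⁻¹ * (cauchyTransform hN α z (X * f + (1 / N) • derivative f) +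
      gaussMoment hN α 1 / (2 * Real.pi) * I * (f.eval α : ℝ))) =O[offRealAtInfinity]
      fun z => z⁻¹ * (1 : ℂ) :=
    (Asymptotics.isBigO_refl _ _).mul
      ((cauchyTransform_isBigO_one hN α _).add (Asymptotics.isBigO_const_const _ one_ne_zero _))
  refine h.congr' ?_ (.of_forall fun z => mul_one _)
  filter_upwards [eventually_im_ne_zero, eventually_ne_zero_offRealAtInfinity] with z hz hz'
  rw [← mul_cauchyTransform hN α f hz]
  field_simp

/-- As long as a factor X - α remains, multiplication by z has no boundary term and only lowers the
exponent of that factor. When the factors are used up, the boundary term supplies the leading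
constant. -/
theorem pow_mul_cauchyTransform_sub_isBigO (k : ℕ) (f : ℝ[X]) :
    (fun z => z ^ (k + 1) * cauchyTransform hN α z ((X - C α) ^ k * f) -
      gaussMoment hN α 1 / (2 * Real.pi) * I * (N⁻¹ ^ k * k.factorial * f.eval α : ℝ))
      =O[offRealAtInfinity] fun z => z⁻¹ := by
  induction k generalizing f with
  | zero =>
    refine (cauchyTransform_isBigO_inv hN α (X * f + (1 / N) • derivative f)).congr' ?_ .rfl
    filter_upwards [eventually_im_ne_zero] with z hz
    rw [pow_zero, one_mul, zero_add, pow_one, mul_cauchyTransform hN α f hz]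
    simp
  | succ k ih =>
    -- Chosen so that Xh + h'/N = (X - α)^k g for h = (X - α)^(k+1) f; then g(α) = (k+1)f(α)/N,
    -- which accumulates to k!/N^k.
    set g : ℝ[X] := X * (X - C α) * f +
      (1 / N) • (((k + 1 : ℕ) : ℝ[X]) * f + (X - C α) * derivative f) with hg
    refine (ih g).congr' ?_ .rfl
    filter_upwards [eventually_im_ne_zero] with z hz
    have e1 : X * ((X - C α) ^ (k + 1) * f) +
        (1 / N) • derivative ((X - C α) ^ (k + 1) * f) = (X - C α) ^ k * g := by
      rw [hg, derivative_mul, derivative_pow_succ, derivative_sub, derivative_X, derivative_C]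
      simp only [smul_eq_C_mul, Nat.cast_add, Nat.cast_one, map_add, map_natCast, map_one]
      ring
    have e2 : ((X - C α) ^ (k + 1) * f).eval α = 0 := by simp
    rw [pow_succ z (k + 1), mul_assoc (z ^ (k + 1)), mul_cauchyTransform hN α _ hz, e1, e2]
    have e3 : g.eval α = N⁻¹ * (k + 1) * f.eval α := by simp [hg]; ring
    rw [e3]
    push_cast [Nat.factorial_succ, pow_succ]
    ring

theorem pow_mul_cauchyTransform_isBigO {k : ℕ} {f : ℝ[X]} (h : (X - C α) ^ k ∣ f) :
    (fun z => z ^ k * cauchyTransform hN α z f) =O[offRealAtInfinity] fun z => z⁻¹ := by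
  obtain ⟨g, rfl⟩ := h
  have h1 := ((pow_mul_cauchyTransform_sub_isBigO hN α k g).trans
    (show (fun z : ℂ => z⁻¹) =O[offRealAtInfinity] fun _ => (1 : ℂ) from
      ((tendsto_inv₀_cobounded (α := ℂ)).mono_left inf_le_left).isBigO_one ℂ)).add
      (Asymptotics.isBigO_const_const (gaussMoment hN α 1 / (2 * Real.pi) * I *
        (N⁻¹ ^ k * k.factorial * g.eval α : ℝ) : ℂ) one_ne_zero offRealAtInfinity)
  refine ((Asymptotics.isBigO_refl (fun z : ℂ => z⁻¹) offRealAtInfinity).mul h1).congr' ?_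
    (.of_forall fun z => mul_one _)
  filter_upwards [eventually_ne_zero_offRealAtInfinity] with z hz
  rw [sub_add_cancel, pow_succ]
  field_simp

theorem aeval_mul_inv_pow_sub_coeff_isBigO (n : ℕ) : ∀ P : ℝ[X], P.natDegree ≤ n →
    (fun z : ℂ => aeval z P * (z ^ n)⁻¹ - (P.coeff n : ℝ)) =O[offRealAtInfinity]
      fun z => z⁻¹ := by
  induction n with
  | zero =>
    intro P hP
    obtain ⟨c, rfl⟩ := natDegree_eq_zero.1 (Nat.le_zero.1 hP)
    simpa using Asymptotics.isBigO_zero _ _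
  | succ n ih =>
    intro P hP
    have hd : P.divX.natDegree ≤ n := by rw [natDegree_divX_eq_natDegree_tsub_one]; omega
    have h1 : (fun z : ℂ => (z ^ n)⁻¹) =O[offRealAtInfinity] fun _ => (1 : ℂ) := by
      have := ((tendsto_inv₀_cobounded (α := ℂ)).mono_left
        (inf_le_left (b := 𝓟 {z : ℂ | z.im ≠ 0}))).isBigO_one ℂ |>.pow n
      simpa using this
    have h2 : (fun z : ℂ => ((P.coeff 0 : ℝ) : ℂ) * (z⁻¹ * (z ^ n)⁻¹)) =O[offRealAtInfinity]
        fun z => z⁻¹ := by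
      simpa using ((Asymptotics.isBigO_refl (fun z : ℂ => z⁻¹) offRealAtInfinity).mul
        h1).const_mul_left ((P.coeff 0 : ℝ) : ℂ)
    refine ((ih _ hd).add h2).congr' ?_ .rfl
    filter_upwards [eventually_ne_zero_offRealAtInfinity] with z hz
    conv_rhs => rw [← X_mul_divX_add P]
    simp only [coeff_divX, map_add, map_mul, aeval_X, aeval_C, coe_algebraMap, coeff_add,
      coeff_X_mul, coeff_C_succ, add_zero, coeff_X_mul]
    field_simp
    ring

end

/-! ### Uniqueness for the Riemann-Hilbert problem -/

/-- Morera's theorem, with each rectangle cut along the real axis. -/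
theorem differentiable_of_continuous_of_differentiableOn_im_ne_zero {G : ℂ → ℂ}
    (hc : Continuous G) (hd : DifferentiableOn ℂ G {z : ℂ | z.im ≠ 0}) : Differentiable ℂ G := by
  have hopen : IsOpen {z : ℂ | z.im ≠ 0} := isOpen_ne_fun continuous_im continuous_const
  have hcons : IsConservativeOn G univ := by
    intro z w _
    rw [← add_eq_zero_iff_eq_neg, wedgeIntegral_add_wedgeIntegral_eq]
    -- Each piece has a side on the real axis, so its open interior avoids the axis; continuity
    -- suffices on the boundary.
    have h1 := integral_boundary_rect_eq_zero_of_continuousOn_of_differentiableOn G z ⟨w.re, 0⟩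
      hc.continuousOn (hd.mono fun u hu h0 => by
        have := hu.2
        simp only [mem_preimage, h0, mem_Ioo] at this
        rcases le_total z.im 0 with h | h <;> simp [h] at this)
    have h2 := integral_boundary_rect_eq_zero_of_continuousOn_of_differentiableOn G ⟨z.re, 0⟩ w
      hc.continuousOn (hd.mono fun u hu h0 => by
        have := hu.2
        simp only [mem_preimage, h0, mem_Ioo] at this
        rcases le_total w.im 0 with h | h <;> simp [h] at this)
    have hv (r : ℝ) : (∫ y : ℝ in z.im..w.im, G (r + y * I)) =
        (∫ y : ℝ in z.im..0, G (r + y * I)) + ∫ y : ℝ in (0 : ℝ)..w.im, G (r + y * I) :=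
      (intervalIntegral.integral_add_adjacent_intervals
        (Continuous.intervalIntegrable (by fun_prop) _ _)
        (Continuous.intervalIntegrable (by fun_prop) _ _)).symm
    rw [hv, hv]
    simp only [smul_eq_mul] at h1 h2 ⊢
    linear_combination h1 + h2
  intro z
  have := (hcons.mono (subset_univ (Metric.ball z 1))).isExactOn_ball hc.continuousOn
  exact (this.differentiableOn Metric.isOpen_ball).differentiableAt
    (Metric.isOpen_ball.mem_nhds (Metric.mem_ball_self one_pos))

theorem dense_im_ne_zero : Dense {z : ℂ | z.im ≠ 0} := by
  have : {z : ℂ | z.im ≠ 0} = im ⁻¹' {0}ᶜ := rfl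
  rw [this]
  exact (dense_compl_singleton (0 : ℝ)).preimage isOpenMap_im

/-- Having limits at real points from both sides at once gives a continuous extension, entire by
Morera; Liouville then makes it constant. -/
theorem eq_of_tendsto_nhdsWithin_im_ne_zero {g : ℂ → ℂ} {c : ℂ}
    (hg : DifferentiableOn ℂ g {z : ℂ | z.im ≠ 0})
    (hlim : ∀ x : ℝ, ∃ y, Tendsto g (𝓝[{z : ℂ | z.im ≠ 0}] (x : ℂ)) (𝓝 y))
    (hinf : Tendsto g offRealAtInfinity (𝓝 c)) {z : ℂ} (hz : z.im ≠ 0) : g z = c := by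
  set S := {z : ℂ | z.im ≠ 0}
  have hlim' : ∀ z, ∃ y, Tendsto g (𝓝[S] z) (𝓝 y) := by
    intro z
    by_cases h : z.im = 0
    · obtain ⟨y, hy⟩ := hlim z.re
      have : ((z.re : ℝ) : ℂ) = z := Complex.ext rfl (by simp [h])
      exact ⟨y, by rwa [this] at hy⟩
    · exact ⟨g z, hg.continuousOn z h⟩
  have hcont : Continuous (extendFrom S g) := continuous_extendFrom dense_im_ne_zero hlim'
  have hext : ∀ z ∈ S, extendFrom S g z = g z := extendFrom_extends hg.continuousOn
  have hdiff := differentiable_of_continuous_of_differentiableOn_im_ne_zero hcont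
    (hg.congr hext)
  rw [← hext z hz]
  refine hdiff.apply_eq_of_tendsto_cocompact z ?_
  rw [← Metric.cobounded_eq_cocompact]
  -- Closed balls, because the bound is known only off the real axis and reaches real points by
  -- closure.
  refine Metric.nhds_basis_closedBall.tendsto_right_iff.2 fun ε hε => ?_
  have h1 := hinf.eventually (Metric.closedBall_mem_nhds c hε)
  rw [eventually_inf_principal, (Metric.hasBasis_cobounded_compl_closedBall (0 : ℂ)).eventually_iff]
    at h1
  obtain ⟨r, -, hr⟩ := h1
  refine (Metric.hasBasis_cobounded_compl_closedBall (0 : ℂ)).eventually_iff.2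
    ⟨r, trivial, fun w hw => ?_⟩
  have hU : IsOpen (Metric.closedBall (0 : ℂ) r)ᶜ := Metric.isClosed_closedBall.isOpen_compl
  have hmem : w ∈ closure (S ∩ (Metric.closedBall (0 : ℂ) r)ᶜ) :=
    dense_im_ne_zero.open_subset_closure_inter hU hw |> (by rwa [inter_comm] at ·)
  refine closure_minimal (fun u hu => ?_)
    (Metric.isClosed_closedBall.preimage hcont) hmem
  rw [mem_preimage, hext u hu.1]
  exact hr hu.2 hu.1

theorem nhdsWithin_im_ne_zero (x : ℂ) :
    𝓝[{z : ℂ | z.im ≠ 0}] x = 𝓝[{z : ℂ | 0 < z.im}] x ⊔ 𝓝[{z : ℂ | z.im < 0}] x := by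
  rw [← nhdsWithin_union]
  congr 1
  ext z
  exact ne_iff_lt_or_gt.trans or_comm

/-- `diag (z^n, z^{-n₁}, z^{-n₂}, z^{-n₃})⁻¹`. -/
abbrev asymptoticDiagonal (n : Fin 3 → ℕ) (z : ℂ) : Matrix (Fin 4) (Fin 4) ℂ :=
  Matrix.diagonal ![(z ^ (∑ l, n l))⁻¹, z ^ (n 0), z ^ (n 1), z ^ (n 2)]

theorem det_asymptoticDiagonal (n : Fin 3 → ℕ) {z : ℂ} (hz : z ≠ 0) :
    (asymptoticDiagonal n z).det = 1 := by
  rw [Matrix.det_diagonal]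
  simp [Fin.prod_univ_succ, Fin.sum_univ_succ, pow_add]
  field_simp

theorem det_jumpMatrix (N a x : ℝ) : (jumpMatrix N a x).det = 1 := by
  rw [Matrix.det_of_isUpperTriangular]
  · simp [Fin.prod_univ_succ, jumpMatrix]
  · intro i j h
    fin_cases i <;> fin_cases j <;> simp_all [jumpMatrix]

section

variable {N a : ℝ} {n : Fin 3 → ℕ} {Y Y' : ℂ → Matrix (Fin 4) (Fin 4) ℂ}

theorem IsRHSolution.tendsto (h : IsRHSolution N a n Y) :
    Tendsto (fun z => Y z * asymptoticDiagonal n z) offRealAtInfinity (𝓝 1) := by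
  refine tendsto_pi_nhds.2 fun i => tendsto_pi_nhds.2 fun j => ?_
  have h1 := (h.asymptotics i j).trans_tendsto
    ((tendsto_inv₀_cobounded (α := ℂ)).mono_left inf_le_left)
  simpa using h1.add_const ((1 : Matrix (Fin 4) (Fin 4) ℂ) i j)

theorem differentiableOn_det {s : Set ℂ} (h : ∀ i j, DifferentiableOn ℂ (fun z => Y z i j) s) :
    DifferentiableOn ℂ (fun z => (Y z).det) s := by
  simp_rw [Matrix.det_apply']
  exact DifferentiableOn.fun_sum fun σ _ => (differentiableOn_const _).mul
    (DifferentiableOn.fun_finsetProd fun i _ => h (σ i) i)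

theorem differentiableOn_adjugate {s : Set ℂ}
    (h : ∀ i j, DifferentiableOn ℂ (fun z => Y z i j) s) (i j : Fin 4) :
    DifferentiableOn ℂ (fun z => (Y z).adjugate i j) s := by
  simp_rw [Matrix.adjugate_apply]
  refine differentiableOn_det fun k l => ?_
  by_cases hk : k = j
  · subst hk
    simp
  · simp_rw [Matrix.updateRow_ne hk]
    exact h k l

theorem IsRHSolution.det_eq_one (h : IsRHSolution N a n Y) {z : ℂ} (hz : z.im ≠ 0) :
    (Y z).det = 1 := by
  refine eq_of_tendsto_nhdsWithin_im_ne_zero (g := fun z => (Y z).det)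
    (differentiableOn_det h.analytic) (fun x => ?_) ?_ hz
  · obtain ⟨U, V, hU, hV, rfl⟩ := h.jump x
    refine ⟨V.det, ?_⟩
    rw [nhdsWithin_im_ne_zero, tendsto_sup]
    have h1 := (Continuous.matrix_det continuous_id).tendsto (V * jumpMatrix N a x) |>.comp hU
    simp only [id, Matrix.det_mul, det_jumpMatrix, mul_one] at h1
    exact ⟨h1, ((Continuous.matrix_det continuous_id).tendsto V).comp hV⟩
  · have h1 := ((Continuous.matrix_det continuous_id).tendsto
      (1 : Matrix (Fin 4) (Fin 4) ℂ)).comp h.tendsto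
    simp only [id, Matrix.det_one] at h1
    refine h1.congr' ?_
    filter_upwards [eventually_ne_zero_offRealAtInfinity] with w hw
    simp only [Function.comp_apply, Matrix.det_mul, det_asymptoticDiagonal n hw, mul_one]

/-- Y'Y⁻¹ has no jump and tends to the identity. The adjugate stands for the inverse: it is
polynomial in the entries, so analyticity and limits pass to it directly. -/
theorem IsRHSolution.eq (h : IsRHSolution N a n Y) (h' : IsRHSolution N a n Y') {z : ℂ}
    (hz : z.im ≠ 0) : Y' z = Y z := by
  have hcont : Continuous fun p : Matrix (Fin 4) (Fin 4) ℂ × Matrix (Fin 4) (Fin 4) ℂ =>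
      p.1 * p.2.adjugate := continuous_fst.matrix_mul continuous_snd.matrix_adjugate
  have key (i j : Fin 4) : (Y' z * (Y z).adjugate) i j = (1 : Matrix (Fin 4) (Fin 4) ℂ) i j := by
    refine eq_of_tendsto_nhdsWithin_im_ne_zero (g := fun z => (Y' z * (Y z).adjugate) i j)
      ?_ (fun x => ?_) ?_ hz
    · simp_rw [Matrix.mul_apply]
      exact DifferentiableOn.fun_sum fun k _ => (h'.analytic i k).mul
        (differentiableOn_adjugate h.analytic k j)
    · obtain ⟨U, V, hU, hV, rfl⟩ := h.jump x
      obtain ⟨U', V', hU', hV', rfl⟩ := h'.jump x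
      refine ⟨(V' * V.adjugate) i j, ?_⟩
      have h1 := (hcont.tendsto _).comp (hU'.prodMk_nhds hU)
      have h2 := (hcont.tendsto _).comp (hV'.prodMk_nhds hV)
      have e : V' * jumpMatrix N a x * (V * jumpMatrix N a x).adjugate = V' * V.adjugate := by
        rw [Matrix.adjugate_mul_distrib, Matrix.mul_assoc, ← Matrix.mul_assoc (jumpMatrix N a x),
          Matrix.mul_adjugate, det_jumpMatrix, one_smul, Matrix.one_mul]
      simp only [e] at h1
      rw [nhdsWithin_im_ne_zero, tendsto_sup]
      exact ⟨tendsto_pi_nhds.1 (tendsto_pi_nhds.1 h1 i) j,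
        tendsto_pi_nhds.1 (tendsto_pi_nhds.1 h2 i) j⟩
    · have h1 := (hcont.tendsto _).comp (h'.tendsto.prodMk_nhds h.tendsto)
      simp only [Matrix.adjugate_one, mul_one] at h1
      refine (tendsto_pi_nhds.1 (tendsto_pi_nhds.1 h1 i) j).congr' ?_
      filter_upwards [eventually_ne_zero_offRealAtInfinity] with w hw
      have e : Y' w * asymptoticDiagonal n w * (Y w * asymptoticDiagonal n w).adjugate =
          Y' w * (Y w).adjugate := by
        rw [Matrix.adjugate_mul_distrib, Matrix.mul_assoc,
          ← Matrix.mul_assoc (asymptoticDiagonal n w),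
          Matrix.mul_adjugate, det_asymptoticDiagonal n hw, one_smul, Matrix.one_mul]
      simp only [Function.comp_apply, e]
  have hkey : Y' z * (Y z).adjugate = 1 := Matrix.ext key
  calc Y' z = Y' z * ((Y z).adjugate * Y z) := by
        rw [Matrix.adjugate_mul, h.det_eq_one hz, one_smul, mul_one]
    _ = Y z := by rw [← mul_assoc, hkey, one_mul]

end

/-! ### The solution -/

/-- The multi-indices `n, n - e₁, n - e₂, n - e₃` of the four rows. -/
def rowIndex (n : Fin 3 → ℕ) : Fin 4 → Fin 3 → ℕ :=
  Fin.cons n fun l => Function.update n l (n l - 1)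

/-- The constants `1, c₁, c₂, c₃`. -/
def rowScale (N a : ℝ) (n : Fin 3 → ℕ) : Fin 4 → ℂ := Fin.cons 1 (cConst N a n)

/-- The polynomials whose raised polynomials are the multiple Hermite polynomials of the rows. -/
def rowPoly (a : ℝ) (n : Fin 3 → ℕ) (i : Fin 4) : ℝ[X] := shiftPoly a (rowIndex n i)

theorem rowPoly_zero (a : ℝ) (n : Fin 3 → ℕ) : rowPoly a n 0 = shiftPoly a n := rfl

theorem rowPoly_succ (a : ℝ) (n : Fin 3 → ℕ) (l : Fin 3) :
    rowPoly a n l.succ = (X - C (shift a l)) ^ (n l - 1) * shiftCofactor a n l := by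
  have : rowPoly a n l.succ = shiftPoly a (Function.update n l (n l - 1)) := rfl
  rw [this, shiftPoly_eq_pow_mul a _ l, Function.update_self]
  congr 1
  exact Finset.prod_congr rfl fun j hj => by
    rw [Function.update_of_ne (Finset.ne_of_mem_erase hj)]

theorem shiftPoly_eq_X_sub_C_mul_rowPoly_succ (a : ℝ) {n : Fin 3 → ℕ} {l : Fin 3}
    (h : 1 ≤ n l) : shiftPoly a n = (X - C (shift a l)) * rowPoly a n l.succ := by
  rw [rowPoly_succ, shiftPoly_eq_pow_mul a n l, ← mul_assoc, ← pow_succ', Nat.sub_add_cancel h]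

theorem derivative_shiftPoly (a : ℝ) (n : Fin 3 → ℕ) :
    derivative (shiftPoly a n) = ∑ l, (n l : ℝ) • rowPoly a n l.succ := by
  rw [shiftPoly, derivative_prod_finset]
  refine Finset.sum_congr rfl fun l _ => ?_
  rw [rowPoly_succ, derivative_X_sub_C_pow, shiftCofactor, smul_eq_C_mul, map_natCast]
  ring

theorem sum_update_sub_one {n : Fin 3 → ℕ} {l : Fin 3} (h : 1 ≤ n l) :
    ∑ j, Function.update n l (n l - 1) j < ∑ j, n j := by
  refine Finset.sum_lt_sum (fun j _ => ?_) ⟨l, Finset.mem_univ _, ?_⟩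
  · by_cases hj : j = l
    · subst hj
      simp
    · rw [Function.update_of_ne hj]
  · rw [Function.update_self]
    omega

theorem X_sub_C_pow_dvd_rowPoly_succ (a : ℝ) (n : Fin 3 → ℕ) {i l : Fin 3} (h : l ≠ i) :
    (X - C (shift a l)) ^ n l ∣ rowPoly a n i.succ := by
  have : rowPoly a n i.succ = shiftPoly a (Function.update n i (n i - 1)) := rfl
  rw [this, shiftPoly_eq_pow_mul a _ l, Function.update_of_ne h]
  exact dvd_mul_right _ _

variable {N : ℝ} (hN : 0 < N) (a : ℝ) (n : Fin 3 → ℕ)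

/-- The constant c_i is exactly what normalises the leading coefficient of the diagonal Cauchy entry
to 1; the sign comes from -i² = 1. -/
theorem cConst_mul {a : ℝ} (ha : a ≠ 0) (i : Fin 3) :
    cConst N a n i * (gaussMoment hN (shift a i) 1 / (2 * Real.pi) * I *
      (N⁻¹ ^ (n i - 1) * (n i - 1).factorial * (shiftCofactor a n i).eval (shift a i) : ℝ)) =
      1 := by
  have hcof : shiftCofactor a (Function.update n i (n i - 1)) i = shiftCofactor a n i :=
    Finset.prod_congr rfl fun j hj => by
      rw [Function.update_of_ne (Finset.ne_of_mem_erase hj)]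
  rw [cConst, hNorm_eq hN ha, Function.update_self, hcof]
  have h1 : (gaussMoment hN (shift a i) 1 : ℂ) ≠ 0 := by
    exact_mod_cast (gaussMoment_one_pos hN _).ne'
  have h2 : ((N⁻¹ ^ (n i - 1) * (n i - 1).factorial *
      (shiftCofactor a n i).eval (shift a i) : ℝ) : ℂ) ≠ 0 := by
    have := eval_shiftCofactor_ne_zero ha n i
    exact_mod_cast mul_ne_zero (mul_ne_zero (pow_ne_zero _ (inv_ne_zero hN.ne'))
      (Nat.cast_ne_zero.2 (Nat.factorial_ne_zero _))) this
  have h3 : (Real.pi : ℂ) ≠ 0 := by exact_mod_cast Real.pi_ne_zero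
  rw [ofReal_mul (_ * _ * _)]
  generalize ((N⁻¹ ^ (n i - 1) * (n i - 1).factorial *
      (shiftCofactor a n i).eval (shift a i) : ℝ) : ℂ) = x at h2 ⊢
  field_simp
  linear_combination (-1 : ℂ) * I_sq

theorem rowScale_ne_zero (hN : 0 < N) {a : ℝ} (ha : a ≠ 0) (i : Fin 4) :
    rowScale N a n i ≠ 0 := by
  refine Fin.cases one_ne_zero (fun l => ?_) i
  exact left_ne_zero_of_mul_eq_one (cConst_mul hN n ha l)

/-- The entries of a row of the solution, up to its constant, as functions of the row polynomial. -/
def columnFunctional (z : ℂ) : Fin 4 → ℝ[X] →ₗ[ℝ] ℂ :=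
  Fin.cons ((aeval z).toLinearMap ∘ₗ raise N) fun l => cauchyTransform hN (shift a l) z

theorem columnFunctional_zero (z : ℂ) (f : ℝ[X]) :
    columnFunctional hN a z 0 f = aeval z (raise N f) := rfl

theorem columnFunctional_succ (z : ℂ) (l : Fin 3) (f : ℝ[X]) :
    columnFunctional hN a z l.succ f = cauchyTransform hN (shift a l) z f := rfl

/-- The solution of the Riemann-Hilbert problem. -/
def rhSolution (z : ℂ) : Matrix (Fin 4) (Fin 4) ℂ :=
  Matrix.of fun i j => rowScale N a n i * columnFunctional hN a z j (rowPoly a n i)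

theorem rhSolution_apply (z : ℂ) (i j : Fin 4) : rhSolution hN a n z i j =
    rowScale N a n i * columnFunctional hN a z j (rowPoly a n i) := rfl

/-! ### The differential equation -/

/-- The logarithmic derivatives, up to `-N`, of the exponential factors of the columns of `Psi`. -/
def exponentRate (z : ℂ) : Fin 4 → ℂ := Fin.cons z fun l => (shift a l : ℂ)

theorem hasDerivAt_columnFunctional (j : Fin 4) (f : ℝ[X]) {z : ℂ} (hz : z.im ≠ 0) :
    HasDerivAt (fun w => columnFunctional hN a w j f)
      (N * (exponentRate a z j * columnFunctional hN a z j f -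
        columnFunctional hN a z j (X * f))) z := by
  refine Fin.cases ?_ (fun l => ?_) j
  · have hN' : (N : ℂ) ≠ 0 := by exact_mod_cast hN.ne'
    have h := congrArg (aeval z) (X_mul_raise N f)
    refine ((raise N f).hasDerivAt_aeval z).congr_deriv ?_
    simp only [columnFunctional_zero, exponentRate, Fin.cons_zero]
    rw [map_mul (aeval z), aeval_X, map_add, map_add, map_smul, map_smul, real_smul] at h
    rw [h, derivative_raise]
    push_cast
    field_simp
    ring
  · exact hasDerivAt_cauchyTransform hN (shift a l) f hz

/-- The boundary term of the Cauchy columns is the value of the polynomial at a_l, which is zero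
because n_l ≥ 1. -/
theorem mul_columnFunctional {n : Fin 3 → ℕ} (hn : ∀ j, 1 ≤ n j) (j : Fin 4) {z : ℂ}
    (hz : z.im ≠ 0) : z * columnFunctional hN a z j (shiftPoly a n) =
      columnFunctional hN a z j (X * shiftPoly a n + (1 / N) • derivative (shiftPoly a n)) := by
  refine Fin.cases ?_ (fun l => ?_) j
  · rw [columnFunctional_zero, columnFunctional_zero, ← X_mul_raise, map_mul, aeval_X]
  · rw [columnFunctional_succ, columnFunctional_succ, mul_cauchyTransform hN _ _ hz,
      shiftPoly_eq_X_sub_C_mul_rowPoly_succ a (hn l)]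
    simp

/-- The coefficient matrix represents multiplication by -X on the row polynomials: the top row
encodes f_0' = ∑ n_l f_l, the others (X - a_l) f_l = f_0. The functional enters only through `hF`.
-/
theorem sum_coeffMatrix_mul (hN : 0 < N) {n : Fin 3 → ℕ} (hn : ∀ j, 1 ≤ n j) {z : ℂ} {F : ℝ[X] →ₗ[ℝ] ℂ}
    (hF : z * F (shiftPoly a n) =
      F (X * shiftPoly a n + (1 / N) • derivative (shiftPoly a n))) (i : Fin 4) :
    N * ∑ k, coeffMatrix N a n z i k * F (rowPoly a n k) = -N * F (X * rowPoly a n i) := by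
  have hN' : (N : ℂ) ≠ 0 := by exact_mod_cast hN.ne'
  rw [Fin.sum_univ_succ, rowPoly_zero]
  refine Fin.cases ?_ (fun l => ?_) i
  · have hrow (l : Fin 3) : coeffMatrix N a n z 0 l.succ = n l / N := by fin_cases l <;> rfl
    have h0 : coeffMatrix N a n z 0 0 = -z := rfl
    simp_rw [hrow, h0, rowPoly_zero, neg_mul, hF, derivative_shiftPoly, map_add, map_smul, map_sum,
      map_smul, real_smul]
    push_cast
    have hs : ∑ l : Fin 3, (n l : ℂ) / N * F (rowPoly a n l.succ) =
        1 / N * ∑ l : Fin 3, (n l : ℂ) * F (rowPoly a n l.succ) := by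
      rw [Finset.mul_sum]
      exact Finset.sum_congr rfl fun l _ => by ring
    rw [hs]
    ring
  · have hrow (k : Fin 3) : coeffMatrix N a n z l.succ k.succ =
        if k = l then -(shift a l : ℂ) else 0 := by
      fin_cases l <;> fin_cases k <;> simp [coeffMatrix, shift]
    have h0 : coeffMatrix N a n z l.succ 0 = -1 := by fin_cases l <;> rfl
    simp_rw [hrow, h0, ite_mul, zero_mul, Finset.sum_ite_eq', Finset.mem_univ, if_true]
    rw [shiftPoly_eq_X_sub_C_mul_rowPoly_succ a (hn l), sub_mul, map_sub, ← smul_eq_C_mul, map_smul,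
      real_smul]
    ring

/-- The exponential factors of the columns of `Psi`. -/
def expFactor (N a : ℝ) (z : ℂ) : Fin 4 → ℂ :=
  Fin.cons (exp (-N * (z ^ 2 / 2))) fun l => exp (-N * shift a l * z)

theorem hasDerivAt_expFactor (N a : ℝ) (z : ℂ) (j : Fin 4) :
    HasDerivAt (fun w => expFactor N a w j) (-N * exponentRate a z j * expFactor N a z j) z := by
  refine Fin.cases ?_ (fun l => ?_) j
  · have h : HasDerivAt (fun w : ℂ => -N * (w ^ 2 / 2)) (-N * z) z := by
      refine ((((hasDerivAt_id z).pow 2).div_const 2).const_mul (-N : ℂ)).congr_deriv ?_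
      simp
    exact h.cexp.congr_deriv (mul_comm _ _)
  · have h : HasDerivAt (fun w : ℂ => -N * shift a l * w) (-N * shift a l) z := by
      simpa using (hasDerivAt_id z).const_mul (-N * shift a l : ℂ)
    exact h.cexp.congr_deriv (mul_comm _ _)

theorem Psi_rhSolution {a : ℝ} (ha : a ≠ 0) (z : ℂ) (i j : Fin 4) :
    Psi N a n (rhSolution hN a n) z i j =
      columnFunctional hN a z j (rowPoly a n i) * expFactor N a z j := by
  have h1 : (![1, 1 / cConst N a n 0, 1 / cConst N a n 1, 1 / cConst N a n 2] : Fin 4 → ℂ) i =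
      (rowScale N a n i)⁻¹ := by
    fin_cases i <;> simp [rowScale, Fin.cons] <;> rfl
  have h2 : (![exp (-N * (z ^ 2 / 2)), exp (-N * shift a 0 * z), exp (-N * shift a 1 * z),
      exp (-N * shift a 2 * z)] : Fin 4 → ℂ) j = expFactor N a z j := by
    fin_cases j <;> rfl
  rw [Psi, Matrix.mul_diagonal, Matrix.diagonal_mul, h1, h2, rhSolution_apply,
    inv_mul_cancel_left₀ (rowScale_ne_zero n hN ha i)]

/-- The exponential factors cancel the column-dependent term `exponentRate`, leaving -N F(Xf) in
every column. -/
theorem hasDerivAt_Psi_rhSolution {a : ℝ} (ha : a ≠ 0) {n : Fin 3 → ℕ} (hn : ∀ j, 1 ≤ n j) {z : ℂ}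
    (hz : z.im ≠ 0) (i j : Fin 4) :
    HasDerivAt (fun w : ℂ => Psi N a n (rhSolution hN a n) w i j)
      (((N : ℂ) • (coeffMatrix N a n z * Psi N a n (rhSolution hN a n) z)) i j) z := by
  have h := sum_coeffMatrix_mul a hN hn (mul_columnFunctional hN a hn j hz) i
  simp_rw [Matrix.smul_apply, Matrix.mul_apply, Psi_rhSolution hN n ha, ← mul_assoc,
    ← Finset.sum_mul]
  refine ((hasDerivAt_columnFunctional hN a j (rowPoly a n i) hz).mul
    (hasDerivAt_expFactor N a z j)).congr_deriv ?_
  rw [smul_eq_mul]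
  linear_combination -expFactor N a z j * h

/-! ### Jump and normalisation of the constructed solution -/

theorem mul_jumpMatrix_succ (M : Matrix (Fin 4) (Fin 4) ℂ) (N a x : ℝ) (i : Fin 4) (l : Fin 3) :
    (M * jumpMatrix N a x) i l.succ = M i 0 * weight N a l x + M i l.succ := by
  fin_cases l <;> simp [Matrix.mul_apply, Fin.sum_univ_succ, jumpMatrix]

theorem mul_jumpMatrix_zero (M : Matrix (Fin 4) (Fin 4) ℂ) (N a x : ℝ) (i : Fin 4) :
    (M * jumpMatrix N a x) i 0 = M i 0 := by
  simp [Matrix.mul_apply, Fin.sum_univ_succ, jumpMatrix]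

theorem cgaussWeight_ofReal (N a : ℝ) (l : Fin 3) (x : ℝ) :
    cgaussWeight N (shift a l) x = weight N a l x := by
  rw [cgaussWeight, weight]
  push_cast
  rfl

theorem rhSolution_jump (x : ℝ) : ∃ Yplus Yminus : Matrix (Fin 4) (Fin 4) ℂ,
    Tendsto (rhSolution hN a n) (𝓝[{z : ℂ | 0 < z.im}] (x : ℂ)) (𝓝 Yplus) ∧
    Tendsto (rhSolution hN a n) (𝓝[{z : ℂ | z.im < 0}] (x : ℂ)) (𝓝 Yminus) ∧
    Yplus = Yminus * jumpMatrix N a x := by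
  choose u v hu hv huv using fun (i : Fin 4) (l : Fin 3) =>
    exists_tendsto_cauchyTransform hN (shift a l) (rowPoly a n i) x
  have hp (i : Fin 4) (s : Set ℂ) :
      Tendsto (fun z : ℂ => aeval z (raise N (rowPoly a n i))) (𝓝[s] (x : ℂ))
        (𝓝 (aeval (x : ℂ) (raise N (rowPoly a n i)))) :=
    ((Polynomial.continuous_aeval _).tendsto _).mono_left nhdsWithin_le_nhds
  refine ⟨Matrix.of fun i => Fin.cons (rowScale N a n i * aeval (x : ℂ) (raise N (rowPoly a n i)))
      fun l => rowScale N a n i * u i l,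
    Matrix.of fun i => Fin.cons (rowScale N a n i * aeval (x : ℂ) (raise N (rowPoly a n i)))
      fun l => rowScale N a n i * v i l, ?_, ?_, ?_⟩
  · refine tendsto_pi_nhds.2 fun i => tendsto_pi_nhds.2 fun j => ?_
    exact Fin.cases ((hp i _).const_mul _) (fun l => (hu i l).const_mul _) j
  · refine tendsto_pi_nhds.2 fun i => tendsto_pi_nhds.2 fun j => ?_
    exact Fin.cases ((hp i _).const_mul _) (fun l => (hv i l).const_mul _) j
  · ext i j
    refine Fin.cases ?_ (fun l => ?_) j
    · rw [mul_jumpMatrix_zero]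
      rfl
    · rw [mul_jumpMatrix_succ]
      simp only [Matrix.of_apply, Fin.cons_zero, Fin.cons_succ, huv, cgaussWeight_ofReal]
      ring

theorem rhSolution_asymptotics {a : ℝ} (ha : a ≠ 0) {n : Fin 3 → ℕ} (hn : ∀ j, 1 ≤ n j)
    (i j : Fin 4) :
    (fun z : ℂ => (rhSolution hN a n z * asymptoticDiagonal n z - 1) i j)
      =O[offRealAtInfinity] fun z => z⁻¹ := by
  simp_rw [Matrix.sub_apply, asymptoticDiagonal, Matrix.mul_diagonal, rhSolution_apply]
  refine Fin.cases ?_ (fun l => ?_) j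
  · simp only [columnFunctional_zero, Matrix.cons_val_zero]
    refine Fin.cases ?_ (fun m => ?_) i
    · obtain ⟨h1, h2⟩ := raise_monic (monic_shiftPoly a n) N
      rw [natDegree_shiftPoly] at h2
      have h := aeval_mul_inv_pow_sub_coeff_isBigO _ _ h2.le
      rw [← h2, h1.coeff_natDegree, h2] at h
      simpa [rowScale, rowPoly_zero] using h
    · have h2 : (raise N (rowPoly a n m.succ)).natDegree < ∑ j, n j := by
        have h3 := (raise_monic (monic_shiftPoly a (rowIndex n m.succ)) N).2
        rw [natDegree_shiftPoly] at h3
        exact h3.trans_lt (sum_update_sub_one (hn m))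
      have h := aeval_mul_inv_pow_sub_coeff_isBigO _ _ h2.le
      rw [coeff_eq_zero_of_natDegree_lt h2] at h
      simpa [mul_assoc, Matrix.one_apply_ne] using h.const_mul_left (rowScale N a n m.succ)
  · have hd (z : ℂ) : (![(z ^ (∑ l, n l))⁻¹, z ^ (n 0), z ^ (n 1), z ^ (n 2)] : Fin 4 → ℂ) l.succ =
        z ^ n l := by fin_cases l <;> rfl
    simp only [columnFunctional_succ, hd]
    -- Off the diagonal the row polynomial contains the full power (X - a_l)^{n_l}, so the entry
    -- decays one order faster than z^{-n_l}.
    have hzero (i : Fin 4) (hne : i ≠ l.succ) (hdvd : (X - C (shift a l)) ^ n l ∣ rowPoly a n i) :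
        (fun z : ℂ => rowScale N a n i * cauchyTransform hN (shift a l) z (rowPoly a n i) *
          z ^ n l - (1 : Matrix (Fin 4) (Fin 4) ℂ) i l.succ) =O[offRealAtInfinity]
          fun z => z⁻¹ := by
      refine ((pow_mul_cauchyTransform_isBigO hN (shift a l) hdvd).const_mul_left
        (rowScale N a n i)).congr_left fun z => ?_
      rw [Matrix.one_apply_ne hne]
      ring
    refine Fin.cases ?_ (fun m => ?_) i
    · refine hzero 0 (Fin.succ_ne_zero l).symm ?_
      rw [rowPoly_zero, shiftPoly_eq_pow_mul a n l]
      exact dvd_mul_right _ _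
    · by_cases hm : m = l
      · subst hm
        -- On the diagonal only the power n_m - 1 is present, so a nonzero leading constant
        -- survives, and c_m normalises it to 1.
        refine ((pow_mul_cauchyTransform_sub_isBigO hN (shift a m) (n m - 1)
          (shiftCofactor a n m)).const_mul_left (cConst N a n m)).congr_left fun z => ?_
        rw [mul_sub, cConst_mul hN n ha m, Nat.sub_add_cancel (hn m), ← rowPoly_succ,
          Matrix.one_apply_eq]
        simp only [rowScale, Fin.cons_succ]
        ring
      · exact hzero m.succ (fun h => hm (Fin.succ_injective _ h))
          (X_sub_C_pow_dvd_rowPoly_succ a n (Ne.symm hm))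

theorem isRHSolution_rhSolution {a : ℝ} (ha : a ≠ 0) {n : Fin 3 → ℕ} (hn : ∀ j, 1 ≤ n j) :
    IsRHSolution N a n (rhSolution hN a n) where
  analytic i j _ hz := ((hasDerivAt_columnFunctional hN a j (rowPoly a n i)
    hz).const_mul _).differentiableAt.differentiableWithinAt
  jump := rhSolution_jump hN a n
  asymptotics := rhSolution_asymptotics hN ha hn

end

end MultipleHermite

theorem mainTheorem4 (N a : ℝ) (hN : 0 < N) (ha : a ≠ 0) (n : Fin 3 → ℕ) (hn : ∀ j, 1 ≤ n j) :
    ∃ Y : ℂ → Matrix (Fin 4) (Fin 4) ℂ,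
      MultipleHermite.IsRHSolution N a n Y ∧
      (∀ Y' : ℂ → Matrix (Fin 4) (Fin 4) ℂ, MultipleHermite.IsRHSolution N a n Y' →
        ∀ z : ℂ, z.im ≠ 0 → Y' z = Y z) ∧
      ∀ z : ℂ, z.im ≠ 0 → ∀ i j : Fin 4,
        HasDerivAt (fun w : ℂ => MultipleHermite.Psi N a n Y w i j)
          (((N : ℂ) • (MultipleHermite.coeffMatrix N a n z * MultipleHermite.Psi N a n Y z)) i j)
          z :=
  have h := MultipleHermite.isRHSolution_rhSolution hN ha hn
  ⟨_, h, fun _ h' _ hz => h.eq h' hz,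
    fun _ hz i j => MultipleHermite.hasDerivAt_Psi_rhSolution hN ha hn hz i j⟩
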